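/- Let $G$ be a finite, connected, simple undirected graph that is outerplanar, i.e. $G$ can be drawn in the plane (vertices as distinct points, edges as simple arcs joining their ends and meeting the vertices and each other only in common ends) so that every vertex lies on the boundary of the unbounded face. Then $cc(G) \le 3$. Here $cc(G)$ is the least number of cops that have a winning strategy in the game of Cops and Attacking Robbers on $G$: first the cops choose their vertices (several cops may share a vertex), then the robber chooses a vertex not occupied by a cop; afterwards the cops and the robber move alternately, the cops first, with full information. In the cops' move each cop stays or goes to a neighbouring vertex, and in the robber's move he does the same; if the robber moves to a vertex occupied by cops, exactly one of these cops is removed from the game. The cops win if after finitely many rounds a (remaining) cop occupies the same vertex as the robber (in particular if the robber cannot be placed at all); otherwise the robber wins. -/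

import Mathlib

/-- A drawing of `G` in the plane `ℂ` without crossings: distinct vertices are distinct points, an
edge is a simple arc (an injective continuous path) between the points of its two ends, an arc
passes through no vertex other than its ends, and two arcs meet only in a common end. -/
structure PlaneEmbedding {V : Type*} (G : SimpleGraph V) where
  point : V → ℂ
  point_injective : Function.Injective point
  arc : Sym2 V → Set ℂ
  arc_spec : ∀ u v : V, G.Adj u v →
    ∃ γ : Path (point u) (point v), Function.Injective γ ∧ Set.range γ = arc s(u, v)
  arc_vertex : ∀ e ∈ G.edgeSet, ∀ w : V, point w ∈ arc e → w ∈ e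
  arc_inter : ∀ e ∈ G.edgeSet, ∀ e' ∈ G.edgeSet, e ≠ e' → ∀ z ∈ arc e ∩ arc e',
    ∃ w : V, w ∈ e ∧ w ∈ e' ∧ z = point w

namespace PlaneEmbedding

variable {V : Type*} {G : SimpleGraph V}

/-- The set of all points of the plane covered by the drawing. -/
def carrier (P : PlaneEmbedding G) : Set ℂ :=
  Set.range P.point ∪ ⋃ e ∈ G.edgeSet, P.arc e

/-- The faces are the connected components of the complement of the drawing. -/
def IsFace (P : PlaneEmbedding G) (F : Set ℂ) : Prop :=
  ∃ z ∈ P.carrierᶜ, F = connectedComponentIn P.carrierᶜ z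

end PlaneEmbedding

/-- `G` has a plane embedding in which every vertex lies on the boundary of the unbounded face. -/
def IsOuterplanar {V : Type*} (G : SimpleGraph V) : Prop :=
  ∃ (P : PlaneEmbedding G) (F : Set ℂ),
    P.IsFace F ∧ ¬ Bornology.IsBounded F ∧ ∀ v : V, P.point v ∈ frontier F

namespace CopsAttackingRobbers

variable {V : Type*}

/-- A single move of a cop or of the robber: pass, or go to a neighbouring vertex. -/
def Step (G : SimpleGraph V) (u v : V) : Prop := u = v ∨ G.Adj u v

/-- A strategy for the cops. A position (cops to move) consists of the multiset `C` of the vertices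
occupied by the cops still in the game and of the vertex `r` of the robber; the strategy answers it
by a move of the cops, in which each cop makes one step. -/
structure CopStrategy (G : SimpleGraph V) where
  move : Multiset V → V → Multiset V
  legal : ∀ (C : Multiset V) (r : V), Multiset.Rel (Step G) C (move C r)

variable [DecidableEq V] {G : SimpleGraph V}

/-- `C n` and `r n` are the positions of the cops and of the robber before the `n`-th move of the
cops, in a play where the cops start on `C₀` and follow `σ`. The robber starts on a vertex without a
cop. In each round the cops move, then the robber makes a step; if there are cops on the vertex he
moves to, exactly one of them is removed (`Multiset.erase` removes one copy if there is one, and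
nothing otherwise). What happens after a capture is irrelevant. -/
def IsPlay (C₀ : Multiset V) (σ : CopStrategy G) (C : ℕ → Multiset V) (r : ℕ → V) : Prop :=
  C 0 = C₀ ∧ r 0 ∉ C₀ ∧
    ∀ n, Step G (r n) (r (n + 1)) ∧ C (n + 1) = (σ.move (C n) (r n)).erase (r (n + 1))

/-- `k` cops win on `G`: they have a starting position and a strategy such that, whatever the robber
does, after finitely many rounds a cop is on the vertex of the robber. This happens either when
the robber attacks a vertex with at least two cops (first case), or by a move of the cops (second
case). -/
def CopsWin (G : SimpleGraph V) (k : ℕ) : Prop :=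
  ∃ (C₀ : Multiset V) (σ : CopStrategy G), C₀.card = k ∧
    ∀ (C : ℕ → Multiset V) (r : ℕ → V), IsPlay C₀ σ C r →
      ∃ n, r n ∈ C n ∨ r n ∈ σ.move (C n) (r n)

/-- The cc-number of `G`: the least number of cops that win (it would be `⊤` if there were none). -/
noncomputable def cc (G : SimpleGraph V) : ℕ∞ :=
  ⨅ (k : ℕ) (_ : CopsWin G k), (k : ℕ∞)

end CopsAttackingRobbers

/-!
Three cops win by shrinking a region. Let `R` be a connected set of vertices with connected
complement, with the robber in `R`, such that only `u` and `v` outside of `R` have neighbours in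
`R`, and let cops stand on `u` and `v`. The robber cannot attack or pass a guard: he would have to
be adjacent to it when the cops are to move. So the third cop can walk to `u` outside of `R`, and
one of the two cops on `u` then moves to a neighbour `x` in `R`. If the robber attacks `x`, the
other one captures him. If `x` separates `u` from `v` within `R`, then the component of `R \ {x}`
with the robber is guarded by `x` and one of `u`, `v`, and its complement is connected again
(`CopsAttackingRobbers.wins_of_guarded`).

Such a neighbour `x` exists if `G` has neither a `K₄` minor nor a `K₂,₃` minor
(`IsOuterplanar.exists_adj_separating`). If there is none, one chooses `x` such that a component `D`
of `R \ {x}` attached to both `u` and `v` is smallest, and repeats this with a neighbour of `u` in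
`D`; the pieces of `R` and of its complement then form one of the two minors.

Outerplanarity excludes these minors because a point of the unbounded face could be joined to a
representative of every branch set, as a further vertex of a `K₅` or a `K₃,₃`. The connections are
only required to avoid the non-adjacent ones. This makes them easy to find, since no accessibility
of the vertices from the face is needed, and no plane separation theorem enters: the
impossibility of such drawings (`PlanarParity.not_planar_K5`, `PlanarParity.not_planar_K33`) is a
parity count. For disjoint paths `γ` and `δ`, the nonvanishing function `γ s - δ t` on a square has a
continuous logarithm, whose total change around the boundary is zero. This is a linear relation
between the numbers of turns of `γ` and `δ` around the ends of each other, and the sum over all pairs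
of non-adjacent edges of `K₅` or `K₃,₃` is contradictory modulo 4.
-/

/-! ### Turns of disjoint plane paths and the nonplanarity of `K₅` and `K₃,₃` -/

/-- The change of a continuous logarithm of a function on `ℝ` does not depend on the logarithm. -/
theorem Complex.sub_eq_sub_of_exp_eq {g h : C(ℝ, ℂ)}
    (H : ∀ t, Complex.exp (g t) = Complex.exp (h t)) (s t : ℝ) : g t - g s = h t - h s := by
  obtain ⟨F, -, hF⟩ := Complex.isCoveringMapOn_exp.existsUnique_continuousMap_lifts
    (⟨fun t => Complex.exp (g t), by fun_prop⟩ : C(ℝ, ℂ)) (a₀ := s) (e₀ := g s) rfl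
    (fun a => Complex.exp_ne_zero _)
  have h₁ := hF g ⟨rfl, rfl⟩
  have h₂ := hF (h + ContinuousMap.const ℝ (g s - h s)) ⟨by simp, by
    have : Complex.exp (g s - h s) = 1 := by
      rw [Complex.exp_sub, H s, div_self (Complex.exp_ne_zero _)]
    ext t
    simp [Complex.exp_add, this, H t]⟩
  have := congrArg (fun f : C(ℝ, ℂ) => f t) (h₁.trans h₂.symm)
  simp only [ContinuousMap.add_apply, ContinuousMap.const_apply] at this
  rw [this]; ring

namespace PlanarParity

variable {ι : Type*} [LinearOrder ι]

/-- A logarithm of `z w - z v`, chosen such that the two orders of `v` and `w` differ by `π * I`. -/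
noncomputable def logDiff (z : ι → ℂ) (v w : ι) : ℂ :=
  if v < w then Complex.log (z w - z v) else Complex.log (z v - z w) + Real.pi * Complex.I

/-- The sign in `logDiff z p q - logDiff z q p = sgn p q * (π * I)`. -/
def sgn (p q : ι) : ℤ := if p < q then -1 else 1

theorem exp_logDiff (z : ι → ℂ) {v w : ι} (h : z v ≠ z w) :
    Complex.exp (logDiff z v w) = z w - z v := by
  unfold logDiff
  split_ifs
  · exact Complex.exp_log (sub_ne_zero.2 h.symm)
  · rw [Complex.exp_add, Complex.exp_pi_mul_I, Complex.exp_log (sub_ne_zero.2 h)]; ring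

theorem logDiff_sub_logDiff (z : ι → ℂ) {p q : ι} (h : p ≠ q) :
    logDiff z p q - logDiff z q p = sgn p q * (Real.pi * Complex.I) := by
  unfold logDiff sgn
  rcases lt_or_gt_of_ne h with h | h
  · simp [h, h.not_gt]
  · simp [h, h.not_gt]

/-- The number of turns of a path `γ` from `z x` to `z y` around `z v`, compared with the chosen
logarithms of `z x - z v` and `z y - z v`. -/
theorem exists_turns (z : ι → ℂ) {x y : ι} (γ : Path (z x) (z y)) (v : ι) :
    ∃ n : ℤ, ∀ g : C(ℝ, ℂ), (∀ t, Complex.exp (g t) = γ.extend t - z v) →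
      g 1 - g 0 = logDiff z v y - logDiff z v x + n * (2 * Real.pi * Complex.I) := by
  by_cases hex : ∃ g : C(ℝ, ℂ), ∀ t, Complex.exp (g t) = γ.extend t - z v
  · obtain ⟨g, hg⟩ := hex
    have hx : z v ≠ z x := fun h => Complex.exp_ne_zero (g 0) (by simp [hg 0, h])
    have hy : z v ≠ z y := fun h => Complex.exp_ne_zero (g 1) (by simp [hg 1, h])
    have h : Complex.exp (g 1 - g 0) = Complex.exp (logDiff z v y - logDiff z v x) := by
      rw [Complex.exp_sub, Complex.exp_sub, exp_logDiff z hx, exp_logDiff z hy, hg, hg]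
      simp
    obtain ⟨n, hn⟩ := Complex.exp_eq_exp_iff_exists_int.1 h
    refine ⟨n, fun g' hg' => ?_⟩
    rw [← hn]
    exact Complex.sub_eq_sub_of_exp_eq (fun t => by rw [hg, hg']) 0 1
  · exact ⟨0, fun g hg => (hex ⟨g, hg⟩).elim⟩

/-- For two disjoint paths `γ` and `δ` the difference `γ s - δ t` has a continuous logarithm on the
square. Its change around the boundary vanishes, which relates the turns of each of the two paths
around the ends of the other. -/
theorem turns_relation (z : ι → ℂ) {a b c d : ι} (γ : Path (z a) (z b)) (δ : Path (z c) (z d))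
    (hd : Disjoint (Set.range γ) (Set.range δ)) {nc nd na nb : ℤ}
    (hnc : ∀ g : C(ℝ, ℂ), (∀ t, Complex.exp (g t) = γ.extend t - z c) →
      g 1 - g 0 = logDiff z c b - logDiff z c a + nc * (2 * Real.pi * Complex.I))
    (hnd : ∀ g : C(ℝ, ℂ), (∀ t, Complex.exp (g t) = γ.extend t - z d) →
      g 1 - g 0 = logDiff z d b - logDiff z d a + nd * (2 * Real.pi * Complex.I))
    (hna : ∀ g : C(ℝ, ℂ), (∀ t, Complex.exp (g t) = δ.extend t - z a) →
      g 1 - g 0 = logDiff z a d - logDiff z a c + na * (2 * Real.pi * Complex.I))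
    (hnb : ∀ g : C(ℝ, ℂ), (∀ t, Complex.exp (g t) = δ.extend t - z b) →
      g 1 - g 0 = logDiff z b d - logDiff z b c + nb * (2 * Real.pi * Complex.I)) :
    sgn c b + sgn b d + sgn d a + sgn a c + 2 * (nc + nb - nd - na) = 0 := by
  have hne : ∀ s t : ℝ, γ.extend s ≠ δ.extend t := fun s t =>
    Set.disjoint_iff_forall_ne.1 hd (by rw [← γ.extend_range]; exact ⟨s, rfl⟩)
      (by rw [← δ.extend_range]; exact ⟨t, rfl⟩)
  have hac : a ≠ c := by rintro rfl; exact hne 0 0 (by simp)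
  have had : a ≠ d := by rintro rfl; exact hne 0 1 (by simp)
  have hbc : b ≠ c := by rintro rfl; exact hne 1 0 (by simp)
  have hbd : b ≠ d := by rintro rfl; exact hne 1 1 (by simp)
  have hγ : Continuous γ.extend := γ.continuous_extend
  have hδ : Continuous δ.extend := δ.continuous_extend
  obtain ⟨F, ⟨-, hF⟩, -⟩ := Complex.isCoveringMapOn_exp.existsUnique_continuousMap_lifts
    (⟨fun p => γ.extend p.1 - δ.extend p.2, by fun_prop⟩ : C(ℝ × ℝ, ℂ)) (a₀ := (0, 0))
    (e₀ := Complex.log (γ.extend 0 - δ.extend 0)) (Complex.exp_log (sub_ne_zero.2 (hne 0 0)))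
    (fun p => sub_ne_zero.2 (hne p.1 p.2))
  replace hF : ∀ s t, Complex.exp (F (s, t)) = γ.extend s - δ.extend t :=
    fun s t => congrFun hF (s, t)
  have h₁ := hnc ⟨fun s => F (s, 0), by fun_prop⟩ (fun s => by simp [hF])
  have h₂ := hnd ⟨fun s => F (s, 1), by fun_prop⟩ (fun s => by simp [hF])
  -- The differences here are `z a - δ t` and `z b - δ t`; adding `π * I` changes their sign.
  have h₃ := hna ⟨fun t => F (0, t) + Real.pi * Complex.I, by fun_prop⟩
    (fun t => by simp [hF, Complex.exp_add])
  have h₄ := hnb ⟨fun t => F (1, t) + Real.pi * Complex.I, by fun_prop⟩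
    (fun t => by simp [hF, Complex.exp_add])
  simp only [ContinuousMap.coe_mk] at h₁ h₂ h₃ h₄
  have e₁ := logDiff_sub_logDiff z hbc.symm
  have e₂ := logDiff_sub_logDiff z hbd
  have e₃ := logDiff_sub_logDiff z had.symm
  have e₄ := logDiff_sub_logDiff z hac
  have key : ((sgn c b + sgn b d + sgn d a + sgn a c + 2 * (nc + nb - nd - na) : ℤ) : ℂ)
      * (Real.pi * Complex.I) = 0 := by
    push_cast
    linear_combination (-e₁) - e₂ - e₃ - e₄ - h₁ + h₂ + h₃ - h₄
  have hpi : (Real.pi * Complex.I : ℂ) ≠ 0 := by simp [Real.pi_ne_zero]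
  exact_mod_cast (mul_eq_zero.1 key).resolve_right hpi

/-- The parity obstruction to drawing a graph in the plane without crossings of non-adjacent edges:
if `E a b` is a connection of `z a` and `z b`, then the numbers of turns `n v a b` satisfy one
linear equation for each pair of disjoint connections. Crossings of adjacent edges do not matter. -/
theorem exists_turns_relations (z : ι → ℂ) (E : ι → ι → Set ℂ) :
    ∃ n : ι → ι → ι → ℤ, ∀ a b c d, JoinedIn (E a b) (z a) (z b) → JoinedIn (E c d) (z c) (z d) →
      Disjoint (E a b) (E c d) →
      sgn c b + sgn b d + sgn d a + sgn a c +
        2 * (n c a b + n b c d - n d a b - n a c d) = 0 := by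
  classical
  let γ : ∀ a b, Path (z a) (z b) := fun a b =>
    if h : JoinedIn (E a b) (z a) (z b) then h.somePath
    else (PathConnectedSpace.joined (z a) (z b)).somePath
  have hγ : ∀ a b, JoinedIn (E a b) (z a) (z b) → Set.range (γ a b) ⊆ E a b := by
    rintro a b h _ ⟨t, rfl⟩
    simp only [γ, dif_pos h]
    exact h.somePath_mem t
  choose n hn using fun v x y => exists_turns z (γ x y) v
  exact ⟨n, fun a b c d hab hcd hd => turns_relation z (γ a b) (γ c d)
    (hd.mono (hγ a b hab) (hγ c d hcd)) (hn c a b) (hn d a b) (hn a c d) (hn b c d)⟩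

/-- `K₅` has no plane drawing in which non-adjacent edges are disjoint. Every turn number occurs
exactly twice in the sum of the 15 relations, while the sum of the signs is not divisible by 4. -/
theorem not_planar_K5 (z : Fin 5 → ℂ) (E : Fin 5 → Fin 5 → Set ℂ)
    (hE : ∀ a b, a < b → JoinedIn (E a b) (z a) (z b))
    (hd : ∀ a b c d, a < b ∧ c < d ∧ a < c ∧ a ≠ d ∧ b ≠ c ∧ b ≠ d → Disjoint (E a b) (E c d)) :
    False := by
  obtain ⟨n, hn⟩ := exists_turns_relations z E
  have h : ∀ a b c d : Fin 5, a < b ∧ c < d ∧ a < c ∧ a ≠ d ∧ b ≠ c ∧ b ≠ d → _ :=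
    fun a b c d H => hn a b c d (hE a b H.1) (hE c d H.2.1) (hd a b c d H)
  have e1 := h 0 1 2 3 (by decide)
  have e2 := h 0 1 2 4 (by decide)
  have e3 := h 0 1 3 4 (by decide)
  have e4 := h 0 2 1 3 (by decide)
  have e5 := h 0 2 1 4 (by decide)
  have e6 := h 0 2 3 4 (by decide)
  have e7 := h 0 3 1 2 (by decide)
  have e8 := h 0 3 1 4 (by decide)
  have e9 := h 0 3 2 4 (by decide)
  have e10 := h 0 4 1 2 (by decide)
  have e11 := h 0 4 1 3 (by decide)
  have e12 := h 0 4 2 3 (by decide)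
  have e13 := h 1 2 3 4 (by decide)
  have e14 := h 1 3 2 4 (by decide)
  have e15 := h 1 4 2 3 (by decide)
  simp [sgn] at e1 e2 e3 e4 e5 e6 e7 e8 e9 e10 e11 e12 e13 e14 e15
  omega

/-- `K₃,₃` has no plane drawing in which non-adjacent edges are disjoint: again every turn number
occurs twice in the sum of the 18 relations. -/
theorem not_planar_K33 (z w : Fin 3 → ℂ) (E : Fin 3 → Fin 3 → Set ℂ)
    (hE : ∀ a b, JoinedIn (E a b) (z a) (w b))
    (hd : ∀ a b c d, a ≠ c → b ≠ d → Disjoint (E a b) (E c d)) : False := by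
  obtain ⟨n, hn⟩ := exists_turns_relations (ι := Fin 3 ⊕ₗ Fin 3) (fun i => Sum.elim z w (ofLex i))
    (fun i j => Sum.elim (fun a => Sum.elim (fun _ => ∅) (E a) (ofLex j)) (fun _ => ∅) (ofLex i))
  have h : ∀ a b c d, a ≠ c → b ≠ d → _ := fun a b c d hac hbd =>
    hn (Sum.inlₗ a) (Sum.inrₗ b) (Sum.inlₗ c) (Sum.inrₗ d) (hE a b) (hE c d) (hd a b c d hac hbd)
  have e1 := h 0 0 1 1 (by decide) (by decide)
  have e2 := h 0 0 1 2 (by decide) (by decide)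
  have e3 := h 0 1 1 0 (by decide) (by decide)
  have e4 := h 0 1 1 2 (by decide) (by decide)
  have e5 := h 0 2 1 0 (by decide) (by decide)
  have e6 := h 0 2 1 1 (by decide) (by decide)
  have e7 := h 0 0 2 1 (by decide) (by decide)
  have e8 := h 0 0 2 2 (by decide) (by decide)
  have e9 := h 0 1 2 0 (by decide) (by decide)
  have e10 := h 0 1 2 2 (by decide) (by decide)
  have e11 := h 0 2 2 0 (by decide) (by decide)
  have e12 := h 0 2 2 1 (by decide) (by decide)
  have e13 := h 1 0 2 1 (by decide) (by decide)
  have e14 := h 1 0 2 2 (by decide) (by decide)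
  have e15 := h 1 1 2 0 (by decide) (by decide)
  have e16 := h 1 1 2 2 (by decide) (by decide)
  have e17 := h 1 2 2 0 (by decide) (by decide)
  have e18 := h 1 2 2 1 (by decide) (by decide)
  simp [sgn] at e1 e2 e3 e4 e5 e6 e7 e8 e9 e10 e11 e12 e13 e14 e15 e16 e17 e18
  omega

end PlanarParity

/-! ### Connected sets of vertices -/

namespace SimpleGraph

variable {V : Type*} {G : SimpleGraph V}

/-- `y` can be reached from `x` by a walk in `G` with all vertices in `T`; the trivial walk at `x`
is allowed even if `x ∉ T`. -/
def ReachIn (G : SimpleGraph V) (T : Set V) : V → V → Prop :=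
  Relation.ReflTransGen fun a b => a ∈ T ∧ b ∈ T ∧ G.Adj a b

/-- The subgraph of `G` induced by `T` is connected or empty. -/
def ConnOn (G : SimpleGraph V) (T : Set V) : Prop :=
  ∀ x ∈ T, ∀ y ∈ T, G.ReachIn T x y

/-- Some edge of `G` joins `A` and `B`. -/
def Touch (G : SimpleGraph V) (A B : Set V) : Prop :=
  ∃ a ∈ A, ∃ b ∈ B, G.Adj a b

/-- The vertices of the component of `y` in the subgraph induced by `T`, for `y ∈ T`. -/
def compIn (G : SimpleGraph V) (T : Set V) (y : V) : Set V :=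
  {w | w ∈ T ∧ G.ReachIn T y w}

theorem Touch.mono {A B A' B' : Set V} (h : G.Touch A B) (hA : A ⊆ A') (hB : B ⊆ B') :
    G.Touch A' B' := by
  obtain ⟨a, ha, b, hb, hab⟩ := h
  exact ⟨a, hA ha, b, hB hb, hab⟩

theorem touch_singleton {u : V} {B : Set V} : G.Touch {u} B ↔ ∃ b ∈ B, G.Adj u b := by
  simp [Touch]

namespace ReachIn

theorem mono {S T : Set V} (h : S ⊆ T) {x y : V} (hxy : G.ReachIn S x y) : G.ReachIn T x y :=
  Relation.ReflTransGen.mono (p := fun a b => a ∈ T ∧ b ∈ T ∧ G.Adj a b)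
    (fun _ _ h' => ⟨h h'.1, h h'.2.1, h'.2.2⟩) _ _ hxy

theorem trans {T : Set V} {x y z : V} (h : G.ReachIn T x y) (h' : G.ReachIn T y z) :
    G.ReachIn T x z :=
  Relation.ReflTransGen.trans h h'

theorem symm {T : Set V} {x y : V} (h : G.ReachIn T x y) : G.ReachIn T y x :=
  have : Std.Symm fun a b => a ∈ T ∧ b ∈ T ∧ G.Adj a b :=
    ⟨fun _ _ h' => ⟨h'.2.1, h'.1, h'.2.2.symm⟩⟩
  Relation.ReflTransGen.stdSymm.symm _ _ h

theorem single {T : Set V} {x y : V} (hx : x ∈ T) (hy : y ∈ T) (h : G.Adj x y) :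
    G.ReachIn T x y :=
  Relation.ReflTransGen.single ⟨hx, hy, h⟩

end ReachIn

namespace ConnOn

theorem singleton (x : V) : G.ConnOn {x} := by
  rintro _ rfl _ rfl
  exact .refl

theorem union_of_mem {A B : Set V} (hA : G.ConnOn A) (hB : G.ConnOn B) {x : V} (hxA : x ∈ A)
    (hxB : x ∈ B) : G.ConnOn (A ∪ B) := by
  have h : ∀ y ∈ A ∪ B, G.ReachIn (A ∪ B) y x := by
    rintro y (hy | hy)
    · exact (hA y hy x hxA).mono Set.subset_union_left
    · exact (hB y hy x hxB).mono Set.subset_union_right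
  exact fun y hy z hz => (h y hy).trans (h z hz).symm

theorem union_of_touch {A B : Set V} (hA : G.ConnOn A) (hB : G.ConnOn B) (h : G.Touch A B) :
    G.ConnOn (A ∪ B) := by
  obtain ⟨a, ha, b, hb, hab⟩ := h
  have hle : G.ReachIn (A ∪ B) a b := .single (.inl ha) (.inr hb) hab
  have h : ∀ y ∈ A ∪ B, G.ReachIn (A ∪ B) y a := by
    rintro y (hy | hy)
    · exact (hA y hy a ha).mono Set.subset_union_left
    · exact ((hB y hy b hb).mono Set.subset_union_right).trans hle.symm
  exact fun y hy z hz => (h y hy).trans (h z hz).symm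

/-- A connected set has an edge across each of its partitions into two nonempty parts. -/
theorem touch {T A B : Set V} (hT : G.ConnOn T) (hTAB : T ⊆ A ∪ B) {a b : V} (ha : a ∈ A)
    (hb : b ∈ B) (haT : a ∈ T) (hbT : b ∈ T) (hAB : Disjoint A B) : G.Touch A B := by
  by_contra hn
  have : ∀ w, G.ReachIn T a w → w ∈ A := by
    intro w hw
    induction hw with
    | refl => exact ha
    | tail _ h ih =>
      rcases hTAB h.2.1 with h' | h'
      · exact h'
      · exact (hn ⟨_, ih, _, h', h.2.2⟩).elim
  exact Set.disjoint_left.1 hAB (this b (hT a haT b hbT)) hb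

end ConnOn

section compIn

variable {T : Set V} {y : V}

theorem compIn_subset : G.compIn T y ⊆ T := fun _ h => h.1

theorem mem_compIn_self (hy : y ∈ T) : y ∈ G.compIn T y := ⟨hy, .refl⟩

theorem mem_compIn_of_adj {a b : V} (ha : a ∈ G.compIn T y) (hb : b ∈ T) (h : G.Adj a b) :
    b ∈ G.compIn T y :=
  ⟨hb, ha.2.trans (.single ha.1 hb h)⟩

theorem connOn_compIn : G.ConnOn (G.compIn T y) := by
  have h : ∀ w, G.ReachIn T y w → G.ReachIn (G.compIn T y) y w := by
    intro w hw
    induction hw with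
    | refl => exact .refl
    | tail h₁ h₂ ih => exact ih.trans (.single ⟨h₂.1, h₁⟩ ⟨h₂.2.1, h₁.tail h₂⟩ h₂.2.2)
  exact fun a ha b hb => (h a ha.2).symm.trans (h b hb.2)

/-- A connected subset of `T` which meets the component of `y` is contained in it. -/
theorem ConnOn.subset_compIn {S : Set V} (hS : G.ConnOn S) (hST : S ⊆ T) {a : V} (haS : a ∈ S)
    (ha : a ∈ G.compIn T y) : S ⊆ G.compIn T y :=
  fun b hb => ⟨hST hb, ha.2.trans ((hS a haS b hb).mono hST)⟩

/-- If `x` is a vertex of a connected set `R`, then `R` without a component of `R \ {x}` is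
connected. -/
theorem ConnOn.diff_compIn {R : Set V} (hR : G.ConnOn R) {x : V} (hx : x ∈ R) (y : V) :
    G.ConnOn (R \ G.compIn (R \ {x}) y) := by
  set D := G.compIn (R \ {x}) y with hD
  have hxD : x ∉ D := fun h => h.1.2 rfl
  have h : ∀ w, G.ReachIn R w x → w ∉ D → G.ReachIn (R \ D) w x := by
    intro w hw
    induction hw using Relation.ReflTransGen.head_induction_on with
    | refl => exact fun _ => .refl
    | @head a c h₁ _ ih =>
      intro ha
      by_cases hax : a = x
      · rw [hax]; exact .refl
      have hc : c ∉ D := fun hc => ha (mem_compIn_of_adj hc ⟨h₁.1, hax⟩ h₁.2.2.symm)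
      exact (ReachIn.single (T := R \ D) ⟨h₁.1, ha⟩ ⟨h₁.2.1, hc⟩ h₁.2.2).trans (ih hc)
  exact fun a ha b hb => (h a (hR a ha.1 x hx) ha.2).trans (h b (hR b hb.1 x hx) hb.2).symm

/-- A connected set can be split between two of its vertices into connected parts. -/
theorem ConnOn.exists_split {S : Set V} (hS : G.ConnOn S) {u v : V} (hu : u ∈ S)
    (hv : v ∈ S) (huv : u ≠ v) : ∃ A B : Set V, A ∪ B = S ∧ Disjoint A B ∧ G.ConnOn A ∧
      G.ConnOn B ∧ u ∈ A ∧ v ∈ B ∧ G.Touch A B := by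
  have hvB : v ∈ G.compIn (S \ {u}) v := mem_compIn_self ⟨hv, huv.symm⟩
  have huA : u ∈ S \ G.compIn (S \ {u}) v := ⟨hu, fun h => h.1.2 rfl⟩
  have hsub : G.compIn (S \ {u}) v ⊆ S := compIn_subset.trans Set.sdiff_subset
  exact ⟨_, _, Set.sdiff_union_of_subset hsub, Set.disjoint_sdiff_left, hS.diff_compIn hu v,
    connOn_compIn, huA, hvB, hS.touch (Set.sdiff_union_of_subset hsub).ge huA hvB hu hv
      Set.disjoint_sdiff_left⟩

end compIn

end SimpleGraph

/-! ### Drawings of induced subgraphs -/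

namespace PlaneEmbedding

variable {V : Type*} {G : SimpleGraph V} (P : PlaneEmbedding G)

/-- The drawing of the subgraph of `G` induced by `T`. -/
def carrierOn (T : Set V) : Set ℂ :=
  P.point '' T ∪ ⋃ e ∈ {e | e ∈ G.edgeSet ∧ ∀ v ∈ e, v ∈ T}, P.arc e

theorem carrierOn_mono {S T : Set V} (h : S ⊆ T) : P.carrierOn S ⊆ P.carrierOn T :=
  Set.union_subset_union (Set.image_mono h)
    (Set.biUnion_subset_biUnion_left fun _ he => ⟨he.1, fun v hv => h (he.2 v hv)⟩)

theorem carrierOn_subset_carrier (T : Set V) : P.carrierOn T ⊆ P.carrier :=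
  Set.union_subset_union (Set.image_subset_range _ _)
    (Set.biUnion_subset_biUnion_left fun _ he => he.1)

theorem mem_carrierOn {T : Set V} {z : ℂ} : z ∈ P.carrierOn T ↔
    (∃ v ∈ T, P.point v = z) ∨ ∃ e ∈ G.edgeSet, (∀ v ∈ e, v ∈ T) ∧ z ∈ P.arc e := by
  simp [carrierOn, and_assoc]

theorem disjoint_carrierOn {S T : Set V} (h : Disjoint S T) :
    Disjoint (P.carrierOn S) (P.carrierOn T) := by
  rw [Set.disjoint_left] at h ⊢
  intro z hS hT
  rw [mem_carrierOn] at hS hT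
  rcases hS with ⟨v, hv, rfl⟩ | ⟨e, he, heS, hze⟩
  · rcases hT with ⟨w, hw, hvw⟩ | ⟨e, he, heT, hze⟩
    · exact h hv (P.point_injective hvw ▸ hw)
    · exact h hv (heT v (P.arc_vertex e he v hze))
  · rcases hT with ⟨w, hw, rfl⟩ | ⟨e', he', heT, hze'⟩
    · exact h (heS w (P.arc_vertex e he w hze)) hw
    · have hne : e ≠ e' := by
        rintro rfl
        induction e using Sym2.ind with
        | _ a b => exact h (heS a (Sym2.mem_mk_left a b)) (heT a (Sym2.mem_mk_left a b))
      obtain ⟨w, hw, hw', -⟩ := P.arc_inter e he e' he' hne z ⟨hze, hze'⟩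
      exact h (heS w hw) (heT w hw')

theorem joinedIn_carrierOn {T : Set V} {x y : V} (hx : x ∈ T) (h : G.ReachIn T x y) :
    JoinedIn (P.carrierOn T) (P.point x) (P.point y) := by
  induction h with
  | refl => exact JoinedIn.refl (P.mem_carrierOn.2 (.inl ⟨x, hx, rfl⟩))
  | @tail b c _ h ih =>
    refine ih.trans ?_
    obtain ⟨γ, -, hγ⟩ := P.arc_spec b c h.2.2
    refine ⟨γ, fun t => P.mem_carrierOn.2 (.inr ⟨s(b, c), h.2.2, ?_, hγ ▸ ⟨t, rfl⟩⟩)⟩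
    intro v hv
    rcases Sym2.mem_iff.1 hv with rfl | rfl
    exacts [h.1, h.2.1]

theorem isCompact_carrierOn [Finite V] (T : Set V) : IsCompact (P.carrierOn T) := by
  refine (T.toFinite.image _).isCompact.union ?_
  refine (Set.toFinite _).isCompact_biUnion fun e he => ?_
  induction e using Sym2.ind with
  | _ a b =>
    obtain ⟨γ, -, hγ⟩ := P.arc_spec a b he.1
    rw [← hγ]
    exact isCompact_range γ.continuous

/-- Every vertex `v` on the frontier of a face `F` can be joined to any point of `F` by a path
which avoids all edges that do not end in `v`. (It may cross edges at `v`.) -/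
theorem joinedIn_face [Finite V] {F : Set ℂ} (hF : P.IsFace F) {f : ℂ} (hf : f ∈ F) {v : V}
    (hv : P.point v ∈ frontier F) : JoinedIn (P.carrierOn {v}ᶜ)ᶜ f (P.point v) := by
  have hopen : IsOpen (P.carrierOn {v}ᶜ)ᶜ := (P.isCompact_carrierOn _).isClosed.isOpen_compl
  have hmem : P.point v ∈ (P.carrierOn {v}ᶜ)ᶜ := fun h =>
    Set.disjoint_left.1 (P.disjoint_carrierOn disjoint_compl_right)
      (P.mem_carrierOn.2 (.inl ⟨v, Set.mem_singleton v, rfl⟩)) h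
  have hFsub : F ⊆ (P.carrierOn {v}ᶜ)ᶜ := by
    obtain ⟨z, -, rfl⟩ := hF
    exact (connectedComponentIn_subset _ _).trans
      (Set.compl_subset_compl.2 (P.carrierOn_subset_carrier _))
  have hcar : P.carrier = P.carrierOn Set.univ := by
    ext z; simp [carrier, carrierOn]
  have hFpath : IsPathConnected F := by
    obtain ⟨z, hz, rfl⟩ := hF
    refine IsOpen.isConnected_iff_isPathConnected (IsOpen.connectedComponentIn ?_) |>.1
      (isConnected_connectedComponentIn_iff.2 hz)
    rw [hcar]
    exact (P.isCompact_carrierOn _).isClosed.isOpen_compl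
  obtain ⟨ε, hε, hball⟩ := Metric.isOpen_iff.1 hopen _ hmem
  obtain ⟨g, hgF, hg⟩ := Metric.mem_closure_iff.1 (frontier_subset_closure hv) ε hε
  have h₁ : JoinedIn (P.carrierOn {v}ᶜ)ᶜ f g := (hFpath.joinedIn f hf g hgF).mono hFsub
  have h₂ : JoinedIn (P.carrierOn {v}ᶜ)ᶜ g (P.point v) :=
    (((convex_ball (P.point v) ε).isPathConnected ⟨_, Metric.mem_ball_self hε⟩).joinedIn g
      (by rwa [Metric.mem_ball, dist_comm]) _ (Metric.mem_ball_self hε)).mono hball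
  exact h₁.trans h₂

end PlaneEmbedding

/-! ### Excluded minors of outerplanar graphs -/

namespace IsOuterplanar

open SimpleGraph

variable {V : Type*} {G : SimpleGraph V}

/-- An outerplanar graph has no `K₄` minor: together with a point of the unbounded face, it would
yield a drawing of `K₅`. -/
theorem not_K4_minor [Finite V] (hG : IsOuterplanar G) (B : Fin 4 → Set V)
    (hconn : ∀ i, G.ConnOn (B i)) (hdisj : ∀ i j, i < j → Disjoint (B i) (B j))
    (htouch : ∀ i j, i < j → G.Touch (B i) (B j)) : False := by
  obtain ⟨P, F, hF, -, hfr⟩ := hG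
  obtain ⟨f, hf⟩ : F.Nonempty := by
    obtain ⟨z, hz, rfl⟩ := hF
    exact ⟨z, mem_connectedComponentIn hz⟩
  have hne : ∀ i, (B i).Nonempty := by
    intro i
    rcases eq_or_ne i 3 with rfl | h
    · obtain ⟨_, -, b, hb, -⟩ := htouch 0 3 (by decide)
      exact ⟨b, hb⟩
    · obtain ⟨a, ha, -⟩ := htouch i 3 (by omega)
      exact ⟨a, ha⟩
  have hdisj' : ∀ i j, i ≠ j → Disjoint (B i) (B j) := fun i j h =>
    h.lt_or_gt.elim (hdisj i j) fun h => (hdisj j i h).symm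
  choose r hr using hne
  have hr' : ∀ i j, i ≠ j → r i ∉ B j := fun i j h => Set.disjoint_left.1 (hdisj' i j h) (hr i)
  refine PlanarParity.not_planar_K5 (Fin.snoc (α := fun _ => ℂ) (fun i => P.point (r i)) f)
    (fun a b => Fin.lastCases (motive := fun _ => Set ℂ) ∅
      (fun i => Fin.lastCases (motive := fun _ => Set ℂ) (P.carrierOn {r i}ᶜ)ᶜ
        (fun j => P.carrierOn (B i ∪ B j)) b) a) ?_ ?_
  · intro a b hab
    obtain ⟨i, rfl⟩ : ∃ i : Fin 4, a = i.castSucc := ⟨⟨a, by omega⟩, rfl⟩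
    induction b using Fin.lastCases with
    | last =>
      simp only [Fin.lastCases_last, Fin.lastCases_castSucc, Fin.snoc_last, Fin.snoc_castSucc]
      exact (P.joinedIn_face hF hf (hfr (r i))).symm
    | cast j =>
      have hij : i < j := by simpa using hab
      simpa using P.joinedIn_carrierOn (.inl (hr i)) (((hconn i).union_of_touch (hconn j)
        (htouch i j hij)) _ (.inl (hr i)) _ (.inr (hr j)))
  · have key : ∀ i j k, i ≠ k → j ≠ k →
        Disjoint (P.carrierOn (B i ∪ B j)) (P.carrierOn {r k}ᶜ)ᶜ := by
      intro i j k hik hjk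
      refine Set.disjoint_compl_right_iff_subset.2 (P.carrierOn_mono ?_)
      rw [Set.subset_compl_singleton_iff]
      rintro (h | h)
      exacts [hr' k i hik.symm h, hr' k j hjk.symm h]
    rintro a b c d ⟨hab, hcd, hac, had, hbc, hbd⟩
    obtain ⟨i, rfl⟩ : ∃ i : Fin 4, a = i.castSucc := ⟨⟨a, by omega⟩, rfl⟩
    obtain ⟨k, rfl⟩ : ∃ k : Fin 4, c = k.castSucc := ⟨⟨c, by omega⟩, rfl⟩
    have hik : i ≠ k := fun h => hac.ne (by rw [h])
    induction b using Fin.lastCases with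
    | last =>
      induction d using Fin.lastCases with
      | last => exact (hbd rfl).elim
      | cast l =>
        have hil : i ≠ l := fun h => had (by rw [h])
        simp only [Fin.lastCases_last, Fin.lastCases_castSucc]
        exact (key k l i hik.symm hil.symm).symm
    | cast j =>
      have hjk : j ≠ k := fun h => hbc (by rw [h])
      induction d using Fin.lastCases with
      | last =>
        simp only [Fin.lastCases_last, Fin.lastCases_castSucc]
        exact key i j k hik hjk
      | cast l =>
        have hil : i ≠ l := fun h => had (by rw [h])
        have hjl : j ≠ l := fun h => hbd (by rw [h])
        simp only [Fin.lastCases_castSucc]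
        refine P.disjoint_carrierOn ?_
        simp only [Set.disjoint_union_left, Set.disjoint_union_right]
        exact ⟨⟨hdisj' i k hik, hdisj' j k hjk⟩, hdisj' i l hil, hdisj' j l hjl⟩

/-- An outerplanar graph has no `K₂,₃` minor: together with a point of the unbounded face, it would
yield a drawing of `K₃,₃`. -/
theorem not_K23_minor [Finite V] (hG : IsOuterplanar G) (A : Fin 2 → Set V) (B : Fin 3 → Set V)
    (hA : ∀ i, G.ConnOn (A i)) (hB : ∀ i, G.ConnOn (B i)) (hAA : Disjoint (A 0) (A 1))
    (hBB : ∀ i j, i < j → Disjoint (B i) (B j)) (hAB : ∀ i j, Disjoint (A i) (B j))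
    (htouch : ∀ i j, G.Touch (A i) (B j)) : False := by
  obtain ⟨P, F, hF, -, hfr⟩ := hG
  obtain ⟨f, hf⟩ : F.Nonempty := by
    obtain ⟨z, hz, rfl⟩ := hF
    exact ⟨z, mem_connectedComponentIn hz⟩
  have hneA : ∀ i, (A i).Nonempty := fun i => let ⟨a, ha, _⟩ := htouch i 0; ⟨a, ha⟩
  have hneB : ∀ j, (B j).Nonempty := fun j => let ⟨_, _, b, hb, _⟩ := htouch 0 j; ⟨b, hb⟩
  have hAA' : ∀ i j, i ≠ j → Disjoint (A i) (A j) := by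
    intro i j h
    fin_cases i <;> fin_cases j <;> first | exact hAA | exact hAA.symm | exact (h rfl).elim
  have hBB' : ∀ i j, i ≠ j → Disjoint (B i) (B j) := fun i j h =>
    h.lt_or_gt.elim (hBB i j) fun h => (hBB j i h).symm
  choose r hr using hneA
  choose s hs using hneB
  refine PlanarParity.not_planar_K33 (Fin.snoc (α := fun _ => ℂ) (fun i => P.point (r i)) f)
    (fun j => P.point (s j))
    (fun a j => Fin.lastCases (motive := fun _ => Set ℂ) (P.carrierOn {s j}ᶜ)ᶜ
        (fun i => P.carrierOn (A i ∪ B j)) a) ?_ ?_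
  · intro a j
    induction a using Fin.lastCases with
    | last =>
      simp only [Fin.lastCases_last, Fin.snoc_last]
      exact P.joinedIn_face hF hf (hfr (s j))
    | cast i =>
      simpa using P.joinedIn_carrierOn (.inl (hr i)) (((hA i).union_of_touch (hB j)
        (htouch i j)) _ (.inl (hr i)) _ (.inr (hs j)))
  · have key : ∀ i j l, j ≠ l → Disjoint (P.carrierOn (A i ∪ B j)) (P.carrierOn {s l}ᶜ)ᶜ := by
      intro i j l hjl
      refine Set.disjoint_compl_right_iff_subset.2 (P.carrierOn_mono ?_)
      rw [Set.subset_compl_singleton_iff]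
      rintro (h | h)
      · exact Set.disjoint_left.1 (hAB i l) h (hs l)
      · exact Set.disjoint_left.1 (hBB' j l hjl) h (hs l)
    intro a j c l hac hjl
    induction a using Fin.lastCases with
    | last =>
      induction c using Fin.lastCases with
      | last => exact (hac rfl).elim
      | cast k =>
        simp only [Fin.lastCases_last, Fin.lastCases_castSucc]
        exact (key k l j hjl.symm).symm
    | cast i =>
      induction c using Fin.lastCases with
      | last =>
        simp only [Fin.lastCases_last, Fin.lastCases_castSucc]
        exact key i j l hjl
      | cast k =>
        have hik : i ≠ k := fun h => hac (by rw [h])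
        simp only [Fin.lastCases_castSucc]
        refine P.disjoint_carrierOn ?_
        simp only [Set.disjoint_union_left, Set.disjoint_union_right]
        exact ⟨⟨hAA' i k hik, (hAB k j).symm⟩, hAB i l, hBB' j l hjl⟩

end IsOuterplanar

/-! ### Separating neighbours in outerplanar graphs -/

namespace IsOuterplanar

open SimpleGraph

variable {V : Type*} {G : SimpleGraph V}

/-- If a connected set `R` with connected complement is split into two connected parts, then the
parts cannot both have neighbours at two vertices `u`, `v` outside of `R`: there would be a `K₄`
minor. -/
theorem not_touch_diff [Finite V] (hG : IsOuterplanar G) {R D : Set V} (hR : G.ConnOn R)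
    (hS : G.ConnOn Rᶜ) {u v : V} (hu : u ∉ R) (hv : v ∉ R) (huv : u ≠ v) (hDR : D ⊆ R)
    (hD : G.ConnOn D) (hD' : G.ConnOn (R \ D)) (huD : G.Touch {u} D) (hvD : G.Touch {v} D)
    (huD' : G.Touch {u} (R \ D)) : ¬ G.Touch {v} (R \ D) := by
  intro hvD'
  obtain ⟨A, B, hAB, hdisj, hA, hB, huA, hvB, htAB⟩ := hS.exists_split hu hv huv
  have hAR : Disjoint A R := Set.disjoint_left.2 fun a ha h => (hAB ▸ Or.inl ha : a ∈ Rᶜ) h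
  have hBR : Disjoint B R := Set.disjoint_left.2 fun a ha h => (hAB ▸ Or.inr ha : a ∈ Rᶜ) h
  have huA' : {u} ⊆ A := Set.singleton_subset_iff.2 huA
  have hvB' : {v} ⊆ B := Set.singleton_subset_iff.2 hvB
  obtain ⟨a, ha, -⟩ := touch_singleton.1 huD
  obtain ⟨b, hb, -⟩ := touch_singleton.1 huD'
  have htD : G.Touch D (R \ D) := hR.touch (Set.union_sdiff_cancel hDR).ge ha hb (hDR ha) hb.1
    Set.disjoint_sdiff_right
  refine hG.not_K4_minor ![A, B, D, R \ D] ?_ ?_ ?_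
  · simp [Fin.forall_fin_succ, hA, hB, hD, hD']
  · simp [Fin.forall_fin_succ, hdisj, hAR.mono_right hDR, hAR.mono_right Set.sdiff_subset,
      hBR.mono_right hDR, hBR.mono_right Set.sdiff_subset, Set.disjoint_sdiff_right]
  · simp [Fin.forall_fin_succ, htAB, htD, huD.mono huA' subset_rfl, huD'.mono huA' subset_rfl,
      hvD.mono hvB' subset_rfl, hvD'.mono hvB' subset_rfl]

/-- The separation property of outerplanar graphs behind the strategy: if `R` and its complement
are connected, and `u`, `v` are vertices outside of `R`, then some neighbour `x` of `u` in `R`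
separates `u` from `v` within `R`. -/
theorem exists_adj_separating [Finite V] (hG : IsOuterplanar G) {R : Set V} (hR : G.ConnOn R)
    (hS : G.ConnOn Rᶜ) {u v : V} (hu : u ∉ R) (hv : v ∉ R) (huv : u ≠ v)
    (htu : G.Touch {u} R) : ∃ x ∈ R, G.Adj u x ∧ ∀ y ∈ R \ {x},
      ¬ (G.Touch {u} (G.compIn (R \ {x}) y) ∧ G.Touch {v} (G.compIn (R \ {x}) y)) := by
  by_contra! hcon
  obtain ⟨x₀, hx₀, hux₀⟩ := touch_singleton.1 htu
  obtain ⟨y₀, hy₀, h₀⟩ := hcon x₀ hx₀ hux₀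
  -- A smallest component which is attached to both `u` and `v`.
  obtain ⟨D, ⟨x, hx, hux, y₁, -, rfl, huD, hvD⟩, hmin⟩ := (Set.toFinite {D : Set V | ∃ x ∈ R,
    G.Adj u x ∧ ∃ y ∈ R \ {x}, D = G.compIn (R \ {x}) y ∧ G.Touch {u} D ∧
      G.Touch {v} D}).exists_minimal ⟨_, x₀, hx₀, hux₀, y₀, hy₀, rfl, h₀⟩
  set D := G.compIn (R \ {x}) y₁
  have hD : G.ConnOn D := connOn_compIn
  have hDR : D ⊆ R := compIn_subset.trans Set.sdiff_subset
  have hxD : x ∉ D := fun h => h.1.2 rfl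
  have hA : G.ConnOn (R \ D) := hR.diff_compIn hx y₁
  have huA : G.Touch {u} (R \ D) := ⟨u, rfl, x, ⟨hx, hxD⟩, hux⟩
  have hvA : ¬ G.Touch {v} (R \ D) := hG.not_touch_diff hR hS hu hv huv hDR hD hA huD hvD huA
  obtain ⟨y, hyD, huy⟩ := touch_singleton.1 huD
  obtain ⟨z, hz, huD', hvD'⟩ := hcon y (hDR hyD) huy
  set D' := G.compIn (R \ {y}) z
  have hD' : G.ConnOn D' := connOn_compIn
  have hDR' : D' ⊆ R := compIn_subset.trans Set.sdiff_subset
  have hyD' : y ∉ D' := fun h => h.1.2 rfl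
  have hB : G.ConnOn (R \ D') := hR.diff_compIn (hDR hyD) z
  have hvB : ¬ G.Touch {v} (R \ D') := hG.not_touch_diff hR hS hu hv huv hDR' hD' hB huD' hvD'
    ⟨u, rfl, y, ⟨hDR hyD, hyD'⟩, huy⟩
  -- Otherwise `D'` together with `y` lies in `D`, against the minimality of `D`.
  have hxD' : x ∈ D' := by
    by_contra hxD'
    obtain ⟨a, ha, b, hb, hab⟩ := hR.touch (Set.union_sdiff_cancel hDR').ge (mem_compIn_self hz)
      ⟨hDR hyD, hyD'⟩ hz.1 (hDR hyD) Set.disjoint_sdiff_right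
    have hby : b = y := by
      by_contra h
      exact hb.2 (mem_compIn_of_adj ha ⟨hb.1, h⟩ hab)
    subst hby
    have hsub : D' ∪ {b} ⊆ D := (hD'.union_of_touch (.singleton b)
      ⟨a, ha, b, rfl, hab⟩).subset_compIn (T := R \ {x}) (Set.union_subset
        (fun w hw => ⟨hDR' hw, fun h => hxD' (h ▸ hw)⟩) (Set.singleton_subset_iff.2 hyD.1)) (.inr rfl) hyD
    exact hyD' (hmin ⟨b, hDR hyD, huy, z, hz, rfl, huD', hvD'⟩
      (Set.subset_union_left.trans hsub) hyD)
  have hAD' : R \ D ⊆ D' := hA.subset_compIn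
    (fun w hw => ⟨hw.1, fun h => hw.2 (h ▸ hyD)⟩) ⟨hx, hxD⟩ hxD'
  -- All neighbours of `v` in `R` lie in `D ∩ D'`. A component `M` of `D ∩ D'` with such a neighbour
  -- is attached to both `R \ D` and `R \ D'`; with the two halves of the complement of `R` this is `K₂,₃`.
  obtain ⟨w, hwD, hvw⟩ := touch_singleton.1 hvD
  have hwD' : w ∈ D' := by
    by_contra h
    exact hvB ⟨v, rfl, w, ⟨hDR hwD, h⟩, hvw⟩
  set M := G.compIn (D ∩ D') w with hM
  have hwM : w ∈ M := mem_compIn_self ⟨hwD, hwD'⟩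
  have hMD : M ⊆ D := compIn_subset.trans Set.inter_subset_left
  have hMD' : M ⊆ D' := compIn_subset.trans Set.inter_subset_right
  have htMB : G.Touch M (R \ D') := by
    obtain ⟨a, ha, b, hb, hab⟩ := hD.touch (Set.union_sdiff_cancel hMD).ge hwM
      ⟨hyD, fun h => hyD' (hMD' h)⟩ hwD hyD Set.disjoint_sdiff_right
    exact ⟨a, ha, b, ⟨hDR hb.1, fun h => hb.2 (mem_compIn_of_adj ha ⟨hb.1, h⟩ hab)⟩, hab⟩
  have htMA : G.Touch M (R \ D) := by
    obtain ⟨a, ha, b, hb, hab⟩ := hD'.touch (Set.union_sdiff_cancel hMD').ge hwM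
      ⟨hxD', fun h => hxD (hMD h)⟩ hwD' hxD' Set.disjoint_sdiff_right
    exact ⟨a, ha, b, ⟨hDR' hb.1, fun h => hb.2 (mem_compIn_of_adj ha ⟨h, hb.1⟩ hab)⟩, hab⟩
  obtain ⟨Su, Sv, hSS, hdisj, hSu, hSv, huSu, hvSv, htS⟩ := hS.exists_split hu hv huv
  have hSuR : Disjoint Su R := Set.disjoint_left.2 fun a ha h => (hSS ▸ Or.inl ha : a ∈ Rᶜ) h
  have hSvR : Disjoint Sv R := Set.disjoint_left.2 fun a ha h => (hSS ▸ Or.inr ha : a ∈ Rᶜ) h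
  have hABdisj : Disjoint (R \ D) (R \ D') := Set.disjoint_left.2 fun a ha h => h.2 (hAD' ha)
  refine hG.not_K23_minor ![Su, M] ![R \ D, R \ D', Sv] ?_ ?_ ?_ ?_ ?_ ?_
  · simp [Fin.forall_fin_succ, hSu, hM, connOn_compIn]
  · simp [Fin.forall_fin_succ, hA, hB, hSv]
  · exact hSuR.mono_right (hMD.trans hDR)
  · simp [Fin.forall_fin_succ, hABdisj, hSvR.symm.mono_left Set.sdiff_subset]
  · simp [Fin.forall_fin_succ, hSuR.mono_right Set.sdiff_subset, hdisj,
      Set.disjoint_sdiff_right.mono_left hMD, Set.disjoint_sdiff_right.mono_left hMD',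
      hSvR.symm.mono_left (hMD.trans hDR)]
  · simp [Fin.forall_fin_succ, htS, htMA, htMB,
      show G.Touch Su (R \ D) from ⟨u, huSu, x, ⟨hx, hxD⟩, hux⟩,
      show G.Touch Su (R \ D') from ⟨u, huSu, y, ⟨hDR hyD, hyD'⟩, huy⟩,
      show G.Touch M Sv from ⟨w, hwM, v, hvSv, hvw.symm⟩]

end IsOuterplanar

/-! ### The game -/

namespace CopsAttackingRobbers

variable {V : Type*} {G : SimpleGraph V}

theorem rel_step_refl (C : Multiset V) : Multiset.Rel (Step G) C C :=
  Multiset.rel_refl_of_refl_on fun _ _ => .inl rfl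

variable [DecidableEq V]

/-- With cops on `C` and the robber on `r`, the cops to move, they can force a capture within `n`
rounds. -/
def WinsIn (G : SimpleGraph V) : ℕ → Multiset V → V → Prop
  | 0, C, r => r ∈ C
  | n + 1, C, r => WinsIn G n C r ∨ ∃ C', Multiset.Rel (Step G) C C' ∧
      (r ∈ C' ∨ ∀ r', Step G r r' → WinsIn G n (C'.erase r') r')

/-- The position with cops on `C` and the robber on `r`, the cops to move, is won by the cops. -/
def Wins (G : SimpleGraph V) (C : Multiset V) (r : V) : Prop :=
  ∃ n, WinsIn G n C r

theorem WinsIn.mono {m n : ℕ} (h : m ≤ n) {C : Multiset V} {r : V} (hw : WinsIn G m C r) :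
    WinsIn G n C r := by
  induction h with
  | refl => exact hw
  | step _ ih => exact .inl ih

theorem Wins.of_adj {C : Multiset V} {a r : V} (ha : a ∈ C) (h : G.Adj a r) : Wins G C r := by
  refine ⟨1, .inr ⟨r ::ₘ C.erase a, ?_, .inl (Multiset.mem_cons_self _ _)⟩⟩
  conv_lhs => rw [← Multiset.cons_erase ha]
  exact .cons (.inr h) (rel_step_refl _)

theorem Wins.of_move [Finite V] {C C' : Multiset V} {r : V} (hC : Multiset.Rel (Step G) C C')
    (h : ∀ r', Step G r r' → Wins G (C'.erase r') r') : Wins G C r := by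
  classical
  have : ∀ r', ∃ n, Step G r r' → WinsIn G n (C'.erase r') r' := fun r' => by
    by_cases hr : Step G r r'
    · exact (h r' hr).imp fun n hn _ => hn
    · exact ⟨0, fun h => (hr h).elim⟩
  choose n hn using this
  obtain ⟨N, hN⟩ := (Set.finite_range n).bddAbove
  exact ⟨N + 1, .inr ⟨C', hC, .inr fun r' hr => (hn r' hr).mono (hN ⟨r', rfl⟩)⟩⟩

/-- Cops who win all positions after the robber's placement have a positional winning strategy:
always to play a move which keeps up with the shortest forced capture. -/
theorem copsWin_of_wins (C₀ : Multiset V) (h : ∀ r ∉ C₀, Wins G C₀ r) :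
    CopsWin G C₀.card := by
  have hmove : ∀ C r, ∃ C', Multiset.Rel (Step G) C C' ∧ ∀ n, WinsIn G (n + 1) C r →
      ¬ WinsIn G n C r → r ∈ C' ∨ ∀ r', Step G r r' → WinsIn G n (C'.erase r') r' := by
    intro C r
    by_cases hn : ∃ n, WinsIn G (n + 1) C r ∧ ¬ WinsIn G n C r
    · obtain ⟨n, hn, hn'⟩ := hn
      obtain ⟨C', hC', hw⟩ := hn.resolve_left hn'
      refine ⟨C', hC', fun m hm hm' => ?_⟩
      -- The least number of rounds is unique.
      have h₁ : m < n + 1 := by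
        by_contra hlt
        exact hm' (hn.mono (by omega))
      have h₂ : n < m + 1 := by
        by_contra hlt
        exact hn' (hm.mono (by omega))
      obtain rfl : m = n := by omega
      exact hw
    · exact ⟨C, rel_step_refl C, fun n h₁ h₂ => (hn ⟨n, h₁, h₂⟩).elim⟩
  choose move hlegal hmove using hmove
  refine ⟨C₀, ⟨move, hlegal⟩, rfl, fun C r hplay => ?_⟩
  have key : ∀ n m, WinsIn G n (C m) (r m) → ∃ k, r k ∈ C k ∨ r k ∈ move (C k) (r k) := by
    intro n
    induction n with
    | zero => exact fun m hm => ⟨m, .inl hm⟩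
    | succ n ih =>
      intro m hm
      by_cases hm' : WinsIn G n (C m) (r m)
      · exact ih m hm'
      · rcases hmove _ _ n hm hm' with hcap | hnext
        · exact ⟨m, .inr hcap⟩
        · refine ih (m + 1) ?_
          rw [(hplay.2.2 m).2]
          exact hnext _ (hplay.2.2 m).1
  obtain ⟨n, hn⟩ := h (r 0) hplay.2.1
  exact key n 0 (hplay.1 ▸ hn)

open SimpleGraph

/-- Three cops win if two of them guard the region `R` of the robber, i.e. all the vertices outside
of `R` with neighbours in `R`. The third one walks, outside of `R`, to a guard `u` with neighbours
in `R`, and then one of these two moves to a neighbour `x` in `R` which separates the guards within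
`R`. An attack on `x` is answered from `u`; otherwise two of the three cops guard the component of
`R \ {x}` the robber is in. -/
theorem wins_of_guarded [Finite V] (hG : IsOuterplanar G) (hconn : G.ConnOn Set.univ) {R : Set V}
    {u v w r : V} (hR : G.ConnOn R) (hS : G.ConnOn Rᶜ) (hu : u ∉ R) (hv : v ∉ R) (hw : w ∉ R)
    (hr : r ∈ R) (hguard : ∀ a ∉ R, G.Touch {a} R → a = u ∨ a = v) :
    Wins G {u, v, w} r := by
  induction hk : R.ncard using Nat.strong_induction_on generalizing R u v w r with
  | _ k ih =>
  subst hk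
  wlog huR : G.Touch {u} R generalizing u v
  · obtain ⟨a, ha, b, hb, hab⟩ := hconn.touch (A := Rᶜ) (B := R) (by simp) hu hr trivial trivial
      disjoint_compl_left
    have haR : G.Touch {a} R := ⟨a, rfl, b, hb, hab⟩
    rcases hguard a ha haR with rfl | rfl
    · exact (huR haR).elim
    · have := this hv hu (fun c hc hcR => (hguard c hc hcR).symm) haR
      rwa [Multiset.insert_eq_cons, Multiset.insert_eq_cons, Multiset.cons_swap] at this
  obtain ⟨x, hx, hux, hsep⟩ : ∃ x ∈ R, G.Adj u x ∧ ∀ y ∈ R \ {x},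
      ¬ (G.Touch {u} (G.compIn (R \ {x}) y) ∧ G.Touch {v} (G.compIn (R \ {x}) y) ∧ u ≠ v) := by
    by_cases huv : u = v
    · obtain ⟨x, hx, hux⟩ := touch_singleton.1 huR
      exact ⟨x, hx, hux, fun y _ h => h.2.2 huv⟩
    · obtain ⟨x, hx, hux, h⟩ := hG.exists_adj_separating hR hS hu hv huv huR
      exact ⟨x, hx, hux, fun y hy h' => h y hy ⟨h'.1, h'.2.1⟩⟩
  -- The robber cannot leave `R` unless he is adjacent to a guard.
  have hstay : ∀ {r r'}, r ∈ R → ¬ G.Adj u r → ¬ G.Adj v r → Step G r r' → r' ∈ R := by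
    intro r r' hr hur hvr hstep
    rcases hstep with rfl | hadj
    · exact hr
    · by_contra hr'
      rcases hguard r' hr' ⟨r', rfl, r, hr, hadj.symm⟩ with rfl | rfl
      exacts [hur hadj.symm, hvr hadj.symm]
  have hbase : ∀ r ∈ R, Wins G {u, v, u} r := by
    intro r hr
    by_cases hur : G.Adj u r
    · exact .of_adj (by simp) hur
    by_cases hvr : G.Adj v r
    · exact .of_adj (by simp) hvr
    refine .of_move (C' := {x, v, u}) (.cons (.inr hux) (rel_step_refl _)) fun r' hr' => ?_
    have hr'R := hstay hr hur hvr hr'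
    by_cases hr'x : r' = x
    · subst hr'x
      exact .of_adj (a := u) (by simp [Multiset.insert_eq_cons]) hux
    have hnot : r' ∉ ({x, v, u} : Multiset V) := by
      simp only [Multiset.insert_eq_cons, Multiset.mem_cons, Multiset.mem_singleton, not_or]
      exact ⟨hr'x, fun h => hv (h ▸ hr'R), fun h => hu (h ▸ hr'R)⟩
    rw [Multiset.erase_of_notMem hnot]
    have hr'' : r' ∈ R \ {x} := ⟨hr'R, hr'x⟩
    have hsep := hsep r' hr''
    set D := G.compIn (R \ {x}) r'
    have hDR : D ⊆ R := compIn_subset.trans Set.sdiff_subset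
    have hxD : x ∉ D := fun h => h.1.2 rfl
    have hD : G.ConnOn D := connOn_compIn
    have hDc : G.ConnOn Dᶜ := by
      have hunion : Rᶜ ∪ {x} ∪ (R \ D) = Dᶜ := by
        ext a
        simp only [Set.mem_union, Set.mem_compl_iff, Set.mem_singleton_iff, Set.mem_sdiff]
        constructor
        · rintro ((h | rfl) | h)
          exacts [fun h' => h (hDR h'), hxD, h.2]
        · intro h
          by_cases haR : a ∈ R
          exacts [.inr ⟨haR, h⟩, .inl (.inl haR)]
      rw [← hunion]
      exact (hS.union_of_touch (.singleton x) ⟨u, hu, x, rfl, hux⟩).union_of_mem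
        (hR.diff_compIn hx r') (.inr rfl) ⟨hx, hxD⟩
    have hcard : D.ncard < R.ncard := Set.ncard_lt_ncard ⟨hDR, fun h => hxD (h hx)⟩
    have hmem : r' ∈ D := mem_compIn_self hr''
    have huD : u ∉ D := fun h => hu (hDR h)
    have hvD : v ∉ D := fun h => hv (hDR h)
    have hnbr : ∀ a ∉ D, G.Touch {a} D → a = x ∨ a = u ∨ a = v := by
      intro a ha haD
      by_cases haR : a ∈ R
      · obtain ⟨b, hb, hab⟩ := touch_singleton.1 haD
        by_contra h
        exact ha (mem_compIn_of_adj hb ⟨haR, fun h' => h (.inl h')⟩ hab.symm)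
      · exact .inr (hguard a haR (haD.mono subset_rfl hDR))
    by_cases huT : G.Touch {u} D
    · have := ih _ hcard hD hDc hxD huD hvD hmem (fun a ha haD => by
        rcases hnbr a ha haD with h | h | rfl
        · exact .inl h
        · exact .inr h
        · by_contra hne
          exact hsep ⟨huT, haD, fun h => hne (.inr h.symm)⟩) rfl
      rwa [show ({x, u, v} : Multiset V) = {x, v, u} from by rw [Multiset.pair_comm u v]] at this
    · exact ih _ hcard hD hDc hxD hvD huD hmem (fun a ha haD => by
        rcases hnbr a ha haD with h | rfl | h
        · exact .inl h
        · exact (huT haD).elim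
        · exact .inr h) rfl
  have hwalk : ∀ w, G.ReachIn Rᶜ w u → ∀ r ∈ R, Wins G {u, v, w} r := by
    intro w hw
    induction hw using Relation.ReflTransGen.head_induction_on with
    | refl => exact hbase
    | @head a c hac _ ihw =>
      intro r hr
      by_cases hur : G.Adj u r
      · exact .of_adj (by simp) hur
      by_cases hvr : G.Adj v r
      · exact .of_adj (by simp) hvr
      have hrel : Multiset.Rel (Step G) {u, v, a} {u, v, c} :=
        .cons (.inl rfl) (.cons (.inl rfl) (.cons (.inr hac.2.2) .zero))
      refine .of_move hrel fun r' hr' => ?_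
      have hr'R := hstay hr hur hvr hr'
      have hnot : r' ∉ ({u, v, c} : Multiset V) := by
        simp only [Multiset.insert_eq_cons, Multiset.mem_cons, Multiset.mem_singleton, not_or]
        exact ⟨fun h => hu (h ▸ hr'R), fun h => hv (h ▸ hr'R), fun h => hac.2.1 (h ▸ hr'R)⟩
      rw [Multiset.erase_of_notMem hnot]
      exact ihw r' hr'R
  exact hwalk w (hS w hw u hu) r hr

end CopsAttackingRobbers

theorem theorem2p7 {V : Type*} [Finite V] [DecidableEq V] (G : SimpleGraph V)
    (hconn : G.Connected) (hG : IsOuterplanar G) :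
    CopsAttackingRobbers.cc G ≤ 3 := by
  have huniv : G.ConnOn Set.univ := by
    intro x _ y _
    have := (SimpleGraph.reachable_iff_reflTransGen x y).1 (hconn.preconnected x y)
    exact Relation.ReflTransGen.mono (p := fun a b => a ∈ Set.univ ∧ b ∈ Set.univ ∧ G.Adj a b)
      (fun _ _ h => ⟨trivial, trivial, h⟩) _ _ this
  obtain ⟨a⟩ := hconn.nonempty
  have hwin : CopsAttackingRobbers.CopsWin G 3 := by
    refine CopsAttackingRobbers.copsWin_of_wins {a, a, a} fun r hr => ?_
    have hra : r ∈ Set.univ \ {a} := ⟨trivial, by simpa using hr⟩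
    have ha : a ∉ G.compIn (Set.univ \ {a}) r := fun h => h.1.2 rfl
    refine CopsAttackingRobbers.wins_of_guarded hG huniv SimpleGraph.connOn_compIn ?_ ha ha ha
      (SimpleGraph.mem_compIn_self hra) fun b hb hbR => ?_
    · rw [Set.compl_eq_univ_sdiff]
      exact huniv.diff_compIn trivial r
    · obtain ⟨c, hc, hbc⟩ := SimpleGraph.touch_singleton.1 hbR
      by_contra hba
      exact hb (SimpleGraph.mem_compIn_of_adj hc ⟨trivial, fun h => hba (.inl h)⟩ hbc.symm)
  exact iInf₂_le 3 hwin
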